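/- Let $H^2_{\mathbb R}(\mathbb D,\mathbb C^m)$ be the real Hilbert space of functions $F(z)=\sum_{k\ge 0}A_kz^k$ on the open unit disc $\mathbb D$ with $A_k\in\mathbb R^m$ and $\|F\|^2=\sum_k\|A_k\|^2<\infty$, with inner product $\langle F,H\rangle=\sum_k\langle A_k,B_k\rangle$ for $H(z)=\sum_k B_kz^k$; write $H^2_{\mathbb R}(\mathbb D)$ for $m=1$, and identify $F\in H^2_{\mathbb R}(\mathbb D,\mathbb C^m)$ with its tuple of components $(f_1,\dots,f_m)$, $f_i\in H^2_{\mathbb R}(\mathbb D)$. Let $(T_z^*F)(z)=\frac{F(z)-F(0)}{z}$ be the backward shift. "Subspace" means closed subspace. Let $\mathcal M$ be a subspace of $H^2_{\mathbb R}(\mathbb D)$. Consider the finite-dimensional subspaces $\mathcal F\subset H^2_{\mathbb R}(\mathbb D)$ that are orthogonal to $\mathcal M$ and satisfy $T_z^*f\in\mathcal M\oplus\mathcal F$ for all $f\in\mathcal M$ with $f(0)=0$. If such an $\mathcal F$ exists, $\mathcal M$ is called nearly $T_z^*$-invariant with defect; one of smallest dimension is called the defect space of $\mathcal M$, and its dimension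 is called the defect of $\mathcal M$. **Theorem.** Let $\mathcal M$ be a nonzero subspace of $H^2_{\mathbb R}(\mathbb D)$ that is nearly $T_z^*$-invariant with defect $n$ ($n\ge 0$), and let $e_1,\dots,e_n$ be an orthonormal basis of the defect space. (i) Suppose some $f\in\mathcal M$ has $f(0)\neq 0$. Then there is a unique $g\in\mathcal M$ of unit norm, orthogonal to $\{f\in\mathcal M: f(0)=0\}$, with $g(0)>0$; and there is a closed subspace $\mathcal N$ of $H^2_{\mathbb R}(\mathbb D)\oplus H^2_{\mathbb R}(\mathbb D,\mathbb C^n)$, invariant under $T_z^*\oplus T_z^*$, such that $$\mathcal M=\Big\{gh+z\sum_{i=1}^n h_ie_i:\ (h,h_1,\dots,h_n)\in\mathcal N\Big\},$$ and $\|f\|^2=\|h\|^2+\sum_{i=1}^n\|h_i\|^2$ whenever $(h,h_1,\dots,h_n)\in\mathcal N$ and $f=gh+z\sum_{i=1}^n h_ie_i$. (ii) Suppose every function in $\mathcal M$ vanishes at $0$. Then there is a closed $T_z^*$-invariant subspace $\mathcal N$ of $H^2_{\mathbb R}(\mathbb D,\mathbb C^n)$ such that $$\mathcal M=\Big\{z\sum_{i=1}^n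 h_ie_i:\ (h_1,\dots,h_n)\in\mathcal N\Big\},$$ and $\|f\|^2=\sum_{i=1}^n\|h_i\|^2$ whenever $(h_1,\dots,h_n)\in\mathcal N$ and $f=z\sum_{i=1}^n h_ie_i$. -/

import Mathlib

noncomputable section

namespace RealHardy

open scoped Complex.UnitDisc

/-- Square-summable sequences of Taylor coefficients in `E`, with norm `‖F‖² = ∑ ‖A_k‖²` and,
for a real inner product space `E`, inner product `⟪F, H⟫ = ∑ ⟪A_k, B_k⟫`. An element stands for the function
`F(z) = ∑ A_k z^k` on the unit disc. -/
abbrev HardyOf (E : Type*) [NormedAddCommGroup E] : Type _ := lp (fun _ : ℕ => E) 2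

/-- The real Hardy space `H²_ℝ(𝔻)`: power series with square-summable real coefficients. -/
abbrev H2 : Type := HardyOf ℝ

/-- The `ℂⁿ`-valued real Hardy space `H²_ℝ(𝔻, ℂⁿ)`: power series with square-summable
coefficients in `ℝⁿ`. -/
abbrev H2Vec (n : ℕ) : Type := HardyOf (EuclideanSpace ℝ (Fin n))

/-- The holomorphic function `z ↦ ∑ a_k z^k` on the open unit disc given by an element of
`H²_ℝ(𝔻)`. -/
def toFun (f : H2) : 𝔻 → ℂ := fun z => ∑' k : ℕ, (f k : ℂ) * (z : ℂ) ^ k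

theorem memlp_of_norm_le {E E' : Type*} [NormedAddCommGroup E] [NormedAddCommGroup E']
    (F : HardyOf E) (s : ℕ → ℕ) (hs : Function.Injective s) (u : ℕ → E')
    (hu : ∀ k, ‖u k‖ ≤ ‖F (s k)‖) : Memℓp u 2 := by
  have hp : 0 < (2 : ENNReal).toReal := by norm_num
  refine memℓp_gen (Summable.of_nonneg_of_le (fun k => by positivity) (fun k => ?_)
    (((lp.memℓp F).summable hp).comp_injective hs))
  exact Real.rpow_le_rpow (norm_nonneg _) (hu k) hp.le

/-- The `i`-th component `h_i ∈ H²_ℝ(𝔻)` of `(h_1, …, h_n) ∈ H²_ℝ(𝔻, ℂⁿ)`. -/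
def component {n : ℕ} (i : Fin n) (F : H2Vec n) : H2 :=
  ⟨fun k => F k i, memlp_of_norm_le F id Function.injective_id _
    (fun k => PiLp.norm_apply_le (F k) i)⟩

/-- The backward shift `(T_z^* F)(z) = (F(z) - F(0)) / z`; on coefficients it deletes `A_0` and
moves every other coefficient down by one. -/
def backwardShift {E : Type*} [NormedAddCommGroup E] [NormedSpace ℝ E] :
    HardyOf E →ₗ[ℝ] HardyOf E where
  toFun F := ⟨fun k => F (k + 1), memlp_of_norm_le F (· + 1) (add_left_injective 1) _
    (fun _ => le_rfl)⟩
  map_add' _ _ := rfl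
  map_smul' _ _ := rfl

theorem summable_toFun (f : H2) (z : 𝔻) : Summable fun k : ℕ => (f k : ℂ) * (z : ℂ) ^ k := by
  refine Summable.of_norm_bounded
    ((summable_geometric_of_lt_one (norm_nonneg (z : ℂ)) z.norm_lt_one).mul_left ‖f‖) fun k => ?_
  rw [norm_mul, norm_pow, Complex.norm_real]
  gcongr
  exact lp.norm_apply_le_norm (by norm_num) f k

theorem toFun_sub (f g : H2) (z : 𝔻) : toFun (f - g) z = toFun f z - toFun g z := by
  unfold toFun
  rw [← (summable_toFun f z).tsum_sub (summable_toFun g z)]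
  refine tsum_congr fun k => ?_
  rw [lp.coeFn_sub, Pi.sub_apply]
  push_cast
  ring

theorem toFun_injective : Function.Injective toFun := by
  intro f g h
  rw [← sub_eq_zero]
  have hd : ∀ z, toFun (f - g) z = 0 := fun z => by rw [toFun_sub, h, sub_self]
  generalize f - g = d at hd
  have key : HasFPowerSeriesAt (fun _ : ℂ => (0 : ℂ))
      (FormalMultilinearSeries.ofScalars ℂ (fun k => (d k : ℂ))) 0 := by
    rw [hasFPowerSeriesAt_iff]
    filter_upwards [Metric.ball_mem_nhds (0 : ℂ) one_pos] with z hz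
    have hz' : ‖z‖ < 1 := by simpa using hz
    have h1 := (summable_toFun d (Complex.UnitDisc.mk z hz')).hasSum
    have h2 := hd (Complex.UnitDisc.mk z hz')
    unfold toFun at h2
    rw [h2] at h1
    simpa [FormalMultilinearSeries.coeff_ofScalars, mul_comm] using h1
  have h0 := key.eq_zero
  ext k
  have hk := FormalMultilinearSeries.coeff_ofScalars (𝕜 := ℂ) (p := fun k => (d k : ℂ)) (n := k)
  rw [h0] at hk
  simpa [FormalMultilinearSeries.coeff] using hk.symm

theorem toFun_zero (f : H2) : toFun f 0 = (f 0 : ℂ) := by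
  unfold toFun
  rw [tsum_eq_single 0 (fun k hk => by simp [hk])]
  simp

theorem toFun_backwardShift (f : H2) (z : 𝔻) :
    (z : ℂ) * toFun (backwardShift f) z = toFun f z - toFun f 0 := by
  rw [toFun_zero]
  unfold toFun
  rw [(summable_toFun f z).tsum_eq_zero_add, ← tsum_mul_left]
  simp only [pow_zero, mul_one, add_sub_cancel_left]
  refine tsum_congr fun k => ?_
  change (z : ℂ) * ((f (k + 1) : ℂ) * (z : ℂ) ^ k) = _
  ring

/-- `F` is a finite-dimensional subspace of `H²_ℝ(𝔻)`, orthogonal to `M`, such that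
`T_z^* f ∈ M ⊕ F` whenever `f ∈ M` and `f(0) = 0`. -/
structure AbsorbsDefect (M F : Submodule ℝ H2) : Prop where
  finiteDimensional : FiniteDimensional ℝ F
  orthogonal : M ⟂ F
  backwardShift_mem : ∀ f ∈ M, toFun f 0 = 0 → backwardShift f ∈ M ⊔ F

/-- `F` is a defect space of `M`: it has the smallest dimension among the finite-dimensional
subspaces orthogonal to `M` with `T_z^*(M ∩ z H²_ℝ(𝔻)) ⊆ M ⊕ F`. -/
structure IsDefectSpace (M F : Submodule ℝ H2) : Prop extends AbsorbsDefect M F where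
  finrank_le : ∀ F' : Submodule ℝ H2, AbsorbsDefect M F' →
    Module.finrank ℝ F ≤ Module.finrank ℝ F'

/-- `M` is nearly `T_z^*`-invariant with defect `n`. -/
def IsNearlyInvariantWithDefect (M : Submodule ℝ H2) (n : ℕ) : Prop :=
  ∃ F : Submodule ℝ H2, IsDefectSpace M F ∧ Module.finrank ℝ F = n

/-- `g` is a function of unit norm in `M`, orthogonal to `M ∩ z H²_ℝ(𝔻)`, with `g(0) > 0`
(the value `g(0)` is real). -/
structure IsExtremal (M : Submodule ℝ H2) (g : H2) : Prop where
  mem : g ∈ M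
  norm_eq_one : ‖g‖ = 1
  orthogonal : ∀ f ∈ M, toFun f 0 = 0 → inner ℝ g f = 0
  pos : 0 < (toFun g 0).re

/-- The function `z ∑ h_i e_i` on the disc, where `H = (h_1, …, h_n)`. -/
def defectPart {n : ℕ} (e : Fin n → H2) (H : H2Vec n) : 𝔻 → ℂ :=
  fun z => (z : ℂ) * ∑ i, toFun (component i H) z * toFun (e i) z

/-- Invariance under `T_z^* ⊕ T_z^*` of a subspace of the Hilbert space direct sum
`H²_ℝ(𝔻) ⊕ H²_ℝ(𝔻, ℂⁿ)`. -/
def IsInvariantSum {n : ℕ} (N : Submodule ℝ (WithLp 2 (H2 × H2Vec n))) : Prop :=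
  ∀ p ∈ N, WithLp.toLp 2 (backwardShift p.fst, backwardShift p.snd) ∈ N

end RealHardy

end

/-! ### Strong stability of contractions that are backward shifts up to finite rank. -/

section

open Filter Topology

/-! Subtract from f in M its component along g. The rest vanishes at 0, so its backward shift lies
in M ⊕ F; let R f be its projection onto M. Then f = z R f + j₀(f) g + z ∑ jᵢ(f) eᵢ, and the three
parts account for ‖f‖². Iterating gives power series with coefficients j(R^k f). The backward shift
on them corresponds to R, so N is the range of an isometry on M. When M vanishes at 0, the same
argument runs with g = 0.

The crux is that R^k f → 0 (`tendsto_orbit`); without it the series could lose norm. Suppose first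
that the orbit of f is weakly square-summable, and let q = lim ‖R^k f‖². The correlation ⟨R^k f, S^m
R^(k+m) f⟩ tends to q as k → ∞ and to 0 as m → ∞, and its distance from q is small uniformly in m,
so q = 0 (`tendsto_of_isSmooth`). The range of I - RR* consists of such vectors. On the orthogonal
complement of the stable vectors R is therefore isometric, all coefficients vanish, and y = S^m R^m
y for every m, which forces y = 0 because S is pure. -/

/-- A contraction `R` on a Hilbert space `M ⊆ H` which is a backward shift up to a finite-rank
correction: `f = S R f + ∑ i, j_i(f) θ_i` and `‖f‖² = ‖R f‖² + ∑ i, j_i(f)²`, where `S` is a pure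
isometry with adjoint `B`. -/
structure ShiftDecomposition {M H ι : Type*} [NormedAddCommGroup M] [InnerProductSpace ℝ M]
    [NormedAddCommGroup H] [InnerProductSpace ℝ H] [Fintype ι] (J : M →ₗᵢ[ℝ] H)
    (S B : H →L[ℝ] H) (R : M →L[ℝ] M) (θ : ι → H) (j : ι → M →ₗ[ℝ] ℝ) : Prop where
  inner_shift : ∀ x y, inner ℝ x (S y) = inner ℝ (B x) y
  left_inv : ∀ x, B (S x) = x
  tendsto_pow : ∀ x, Tendsto (fun m : ℕ => (B ^ m) x) atTop (𝓝 0)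
  decomp : ∀ f, J f = S (J (R f)) + ∑ i, j i f • θ i
  norm_sq : ∀ f, ‖f‖ ^ 2 = ‖R f‖ ^ 2 + ∑ i, (j i f) ^ 2

namespace ShiftDecomposition

variable {M H ι : Type*} [NormedAddCommGroup M] [InnerProductSpace ℝ M]
    [NormedAddCommGroup H] [InnerProductSpace ℝ H] [Fintype ι] {J : M →ₗᵢ[ℝ] H}
    {S B : H →L[ℝ] H} {R : M →L[ℝ] M} {θ : ι → H} {j : ι → M →ₗ[ℝ] ℝ}

theorem inner_shift_pow (h : ShiftDecomposition J S B R θ j) (m : ℕ) (x y : H) :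
    inner ℝ x ((S ^ m) y) = inner ℝ ((B ^ m) x) y := by
  induction m generalizing x with
  | zero => simp
  | succ m ih =>
    rw [pow_succ', pow_succ, mul_apply_eq_comp, mul_apply_eq_comp,
      h.inner_shift, ih]

theorem inner_map_map (h : ShiftDecomposition J S B R θ j) (x y : H) :
    inner ℝ (S x) (S y) = inner ℝ x y := by
  rw [h.inner_shift, h.left_inv]

theorem norm_shift (h : ShiftDecomposition J S B R θ j) (x : H) : ‖S x‖ = ‖x‖ := by
  rw [← sq_eq_sq₀ (norm_nonneg _) (norm_nonneg _), ← real_inner_self_eq_norm_sq,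
    ← real_inner_self_eq_norm_sq, h.inner_map_map]

theorem norm_shift_pow (h : ShiftDecomposition J S B R θ j) (m : ℕ) (x : H) :
    ‖(S ^ m) x‖ = ‖x‖ := by
  induction m with
  | zero => simp
  | succ m ih => rw [pow_succ', mul_apply_eq_comp, h.norm_shift, ih]

theorem norm_adjoint_pow_le (h : ShiftDecomposition J S B R θ j) (m : ℕ) (x : H) :
    ‖(B ^ m) x‖ ≤ ‖x‖ := by
  have h1 := h.inner_shift_pow m x ((B ^ m) x)
  rw [real_inner_self_eq_norm_sq] at h1
  have h2 := real_inner_le_norm x ((S ^ m) ((B ^ m) x))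
  rw [h1, h.norm_shift_pow] at h2
  by_contra! hlt
  nlinarith [norm_nonneg x]

theorem norm_map_le (h : ShiftDecomposition J S B R θ j) (f : M) : ‖R f‖ ≤ ‖f‖ := by
  have h1 := h.norm_sq f
  have h2 : 0 ≤ ∑ i, (j i f) ^ 2 := Finset.sum_nonneg fun i _ => sq_nonneg _
  exact le_of_sq_le_sq (by linarith) (norm_nonneg _)

theorem pow_succ_apply (R : M →L[ℝ] M) (k : ℕ) (f : M) : (R ^ (k + 1)) f = R ((R ^ k) f) := by
  rw [pow_succ', mul_apply_eq_comp]

theorem antitone_norm (h : ShiftDecomposition J S B R θ j) (f : M) :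
    Antitone fun k : ℕ => ‖(R ^ k) f‖ :=
  antitone_nat_of_succ_le fun k => by
    rw [pow_succ_apply]
    exact h.norm_map_le _

/-- Telescoping of the norm identity along an orbit. -/
theorem sum_sq_orbit (h : ShiftDecomposition J S B R θ j) (f : M) (k N : ℕ) :
    ∑ a ∈ Finset.range N, ∑ i, (j i ((R ^ (k + a)) f)) ^ 2
      = ‖(R ^ k) f‖ ^ 2 - ‖(R ^ (k + N)) f‖ ^ 2 := by
  induction N with
  | zero => simp
  | succ N ih =>
    rw [Finset.sum_range_succ, ih, ← add_assoc, pow_succ_apply]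
    linarith [h.norm_sq ((R ^ (k + N)) f)]

/-- Iteration of the decomposition along an orbit. -/
theorem decomp_pow (h : ShiftDecomposition J S B R θ j) (f : M) (m : ℕ) :
    J f = (S ^ m) (J ((R ^ m) f)) +
      ∑ a ∈ Finset.range m, (S ^ a) (∑ i, j i ((R ^ a) f) • θ i) := by
  induction m with
  | zero => simp
  | succ m ih =>
    rw [Finset.sum_range_succ, pow_succ_apply R, pow_succ S, mul_apply_eq_comp]
    conv_lhs => rw [ih, h.decomp ((R ^ m) f), map_add]
    abel

/-! ### Correlations along an orbit. -/

/-- Expand the second slot by one step, then the first, and cancel one `S` by isometry. The errors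
pair coefficients with the orbit tested against vectors of norm at most `‖θ i‖`, whatever `m` is. -/
theorem correlation_sub (h : ShiftDecomposition J S B R θ j) (f : M) (k m : ℕ) :
    (inner ℝ (J ((R ^ k) f)) ((S ^ m) (J ((R ^ (k + m)) f))) : ℝ)
      - inner ℝ (J ((R ^ (k + 1)) f)) ((S ^ m) (J ((R ^ (k + 1 + m)) f)))
      = (∑ i, j i ((R ^ k) f) * inner ℝ ((B ^ (m + 1)) (θ i)) (J ((R ^ (k + m + 1)) f)))
        + ∑ i, j i ((R ^ (k + m)) f) * inner ℝ ((S ^ m) (θ i)) (J ((R ^ k) f)) := by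
  have e1 : (S ^ m) (J ((R ^ (k + m)) f)) = (S ^ (m + 1)) (J ((R ^ (k + m + 1)) f)) +
      ∑ i, j i ((R ^ (k + m)) f) • (S ^ m) (θ i) := by
    conv_lhs => rw [h.decomp ((R ^ (k + m)) f), map_add]
    rw [pow_succ S, mul_apply_eq_comp, pow_succ_apply R (k + m), map_sum]
    simp
  have e2 : (inner ℝ (J ((R ^ k) f)) ((S ^ (m + 1)) (J ((R ^ (k + m + 1)) f))) : ℝ) =
      inner ℝ (J ((R ^ (k + 1)) f)) ((S ^ m) (J ((R ^ (k + 1 + m)) f))) +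
      ∑ i, j i ((R ^ k) f) * inner ℝ ((B ^ (m + 1)) (θ i)) (J ((R ^ (k + m + 1)) f)) := by
    conv_lhs => rw [h.decomp ((R ^ k) f), inner_add_left, sum_inner]
    congr 1
    · rw [pow_succ' S, mul_apply_eq_comp, h.inner_map_map, pow_succ_apply R k,
        show k + 1 + m = k + m + 1 by ring]
    · refine Finset.sum_congr rfl fun i _ => ?_
      rw [real_inner_smul_left, h.inner_shift_pow]
  rw [e1, inner_add_right, e2, inner_sum]
  have e3 : ∀ i, (inner ℝ (J ((R ^ k) f)) (j i ((R ^ (k + m)) f) • (S ^ m) (θ i)) : ℝ) =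
      j i ((R ^ (k + m)) f) * inner ℝ ((S ^ m) (θ i)) (J ((R ^ k) f)) := fun i => by
    rw [real_inner_smul_right, real_inner_comm]
  simp only [e3]
  ring

theorem abs_double_sum_mul_le {ι : Type*} [Fintype ι] (N : ℕ) (u v : ℕ → ι → ℝ) {a b : ℝ}
    (hu : ∑ s ∈ Finset.range N, ∑ i, (u s i) ^ 2 ≤ a)
    (hv : ∑ s ∈ Finset.range N, ∑ i, (v s i) ^ 2 ≤ b) :
    |∑ s ∈ Finset.range N, ∑ i, u s i * v s i| ≤ √(a * b) := by
  refine Real.abs_le_sqrt ?_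
  rw [← Finset.sum_product'] at hu hv ⊢
  refine (Finset.sum_mul_sq_le_sq_mul_sq _ _ _).trans ?_
  exact mul_le_mul hu hv (Finset.sum_nonneg fun _ _ => sq_nonneg _)
    ((Finset.sum_nonneg fun _ _ => sq_nonneg _).trans hu)

/-- `f` is smooth for `R` if its orbit is weakly square-summable. -/
def IsSmooth (R : M →L[ℝ] M) (f : M) : Prop :=
  ∃ C : ℝ, ∀ (y : M) (N : ℕ), ∑ a ∈ Finset.range N, (inner ℝ y ((R ^ a) f) : ℝ) ^ 2 ≤ C * ‖y‖ ^ 2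

theorem IsSmooth.sum_shifted_le {f : M} {C : ℝ}
    (hC : ∀ (y : M) (N : ℕ), ∑ a ∈ Finset.range N, (inner ℝ y ((R ^ a) f) : ℝ) ^ 2 ≤ C * ‖y‖ ^ 2)
    (y : M) (k N : ℕ) :
    ∑ a ∈ Finset.range N, (inner ℝ y ((R ^ (k + a)) f) : ℝ) ^ 2 ≤ C * ‖y‖ ^ 2 := by
  refine le_trans ?_ (hC y (k + N))
  rw [Finset.sum_range_add]
  exact le_add_of_nonneg_left (Finset.sum_nonneg fun _ _ => sq_nonneg _)

/-- Smoothness tests only against vectors of `M`, so `v i` is pulled back by the adjoint of `J`, a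
contraction. -/
theorem sum_inner_orbit_le [CompleteSpace M] [CompleteSpace H] {f : M} {C : ℝ} (hC0 : 0 ≤ C)
    (hC : ∀ (y : M) (N : ℕ), ∑ a ∈ Finset.range N, (inner ℝ y ((R ^ a) f) : ℝ) ^ 2 ≤ C * ‖y‖ ^ 2)
    (J : M →ₗᵢ[ℝ] H) (v : ι → H) (hv : ∀ i, ‖v i‖ ≤ ‖θ i‖) (k N : ℕ) :
    ∑ a ∈ Finset.range N, ∑ i, (inner ℝ (v i) (J ((R ^ (k + a)) f)) : ℝ) ^ 2
      ≤ C * ∑ i, ‖θ i‖ ^ 2 := by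
  rw [Finset.sum_comm, Finset.mul_sum]
  refine Finset.sum_le_sum fun i _ => ?_
  set A := ContinuousLinearMap.adjoint J.toContinuousLinearMap
  have hA : ∀ u : M, (inner ℝ (v i) (J u) : ℝ) = inner ℝ (A (v i)) u := fun u =>
    (ContinuousLinearMap.adjoint_inner_left J.toContinuousLinearMap u (v i)).symm
  simp only [hA]
  refine (IsSmooth.sum_shifted_le hC _ k N).trans ?_
  have h1 : ‖A (v i)‖ ≤ ‖θ i‖ := by
    refine ((A.le_opNorm _).trans ?_).trans (hv i)
    have : ‖A‖ ≤ 1 := by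
      rw [LinearIsometryEquiv.norm_map]
      exact J.norm_toContinuousLinearMap_le
    exact mul_le_of_le_one_left (norm_nonneg _) this
  gcongr

/-- Telescope and apply Cauchy–Schwarz: the squared coefficients sum to a drop in `‖R^k f‖²`, and
smoothness controls the other factor. Independence of `m` and `N` is what later permits both limits.
-/
theorem abs_correlation_sub_le [CompleteSpace M] [CompleteSpace H]
    (h : ShiftDecomposition J S B R θ j) {f : M} {C : ℝ} (hC0 : 0 ≤ C)
    (hC : ∀ (y : M) (N : ℕ), ∑ a ∈ Finset.range N, (inner ℝ y ((R ^ a) f) : ℝ) ^ 2 ≤ C * ‖y‖ ^ 2)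
    {q : ℝ} (hq : ∀ k, q ≤ ‖(R ^ k) f‖ ^ 2) (k m N : ℕ) :
    |(inner ℝ (J ((R ^ k) f)) ((S ^ m) (J ((R ^ (k + m)) f))) : ℝ)
      - inner ℝ (J ((R ^ (k + N)) f)) ((S ^ m) (J ((R ^ (k + N + m)) f)))|
      ≤ 2 * √((‖(R ^ k) f‖ ^ 2 - q) * (C * ∑ i, ‖θ i‖ ^ 2)) := by
  have tel : (inner ℝ (J ((R ^ k) f)) ((S ^ m) (J ((R ^ (k + m)) f))) : ℝ)
      - inner ℝ (J ((R ^ (k + N)) f)) ((S ^ m) (J ((R ^ (k + N + m)) f))) =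
      (∑ a ∈ Finset.range N, ∑ i, j i ((R ^ (k + a)) f) *
        inner ℝ ((B ^ (m + 1)) (θ i)) (J ((R ^ (k + m + 1 + a)) f))) +
      ∑ a ∈ Finset.range N, ∑ i, j i ((R ^ (k + m + a)) f) *
        inner ℝ ((S ^ m) (θ i)) (J ((R ^ (k + a)) f)) := by
    induction N with
    | zero => simp
    | succ N ih =>
      have := h.correlation_sub f (k + N) m
      rw [Finset.sum_range_succ, Finset.sum_range_succ,
        show k + m + 1 + N = k + N + m + 1 by ring, show k + m + N = k + N + m by ring,
        show k + (N + 1) = k + N + 1 by ring]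
      linarith
  rw [tel, two_mul]
  refine (abs_add_le _ _).trans (add_le_add ?_ ?_)
  · refine abs_double_sum_mul_le N _ _ ?_ (sum_inner_orbit_le hC0 hC J _
      (fun i => h.norm_adjoint_pow_le _ _) _ _)
    rw [h.sum_sq_orbit]
    linarith [hq (k + N)]
  · refine abs_double_sum_mul_le N _ _ ?_ (sum_inner_orbit_le hC0 hC J _
      (fun i => (h.norm_shift_pow _ _).le) _ _)
    rw [h.sum_sq_orbit]
    -- These coefficients start at `k + m`; monotonicity of the norms brings the bound back to `k`.
    have := h.antitone_norm f (Nat.le_add_right k m)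
    simp only at this
    have h2 : ‖(R ^ (k + m)) f‖ ^ 2 ≤ ‖(R ^ k) f‖ ^ 2 := by gcongr
    linarith [hq (k + m + N)]

theorem tendsto_coeff (h : ShiftDecomposition J S B R θ j) (f : M) (i : ι) :
    Tendsto (fun k : ℕ => j i ((R ^ k) f)) atTop (𝓝 0) := by
  have hs : Summable fun k : ℕ => (j i ((R ^ k) f)) ^ 2 := by
    refine summable_of_sum_range_le (c := ‖f‖ ^ 2) (fun _ => sq_nonneg _) fun N => ?_
    have h1 := h.sum_sq_orbit f 0 N
    simp only [zero_add, pow_zero, one_apply_eq_self] at h1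
    refine (Finset.sum_le_sum fun a _ => Finset.single_le_sum (f := fun i => (j i ((R ^ a) f)) ^ 2)
      (fun _ _ => sq_nonneg _) (Finset.mem_univ i)).trans ?_
    rw [h1]
    linarith [sq_nonneg ‖(R ^ N) f‖]
  have h2 := hs.tendsto_atTop_zero
  have h3 := h2.sqrt
  simp only [Real.sqrt_sq_eq_abs, Real.sqrt_zero] at h3
  exact (tendsto_zero_iff_abs_tendsto_zero _).2 h3

/-- For fixed `m`, the vectors `R^n f` and `S^m R^(n+m) f` differ by finitely many terms whose
coefficients tend to zero. -/
theorem tendsto_correlation (h : ShiftDecomposition J S B R θ j) (f : M) (k m : ℕ) {q : ℝ}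
    (hq : Tendsto (fun k : ℕ => ‖(R ^ k) f‖ ^ 2) atTop (𝓝 q)) :
    Tendsto (fun N : ℕ => (inner ℝ (J ((R ^ (k + N)) f))
      ((S ^ m) (J ((R ^ (k + N + m)) f))) : ℝ)) atTop (𝓝 q) := by
  have hk : Tendsto (fun N : ℕ => k + N) atTop atTop := tendsto_atTop_mono (Nat.le_add_left · k) tendsto_id
  have key : ∀ n, (inner ℝ (J ((R ^ n) f)) ((S ^ m) (J ((R ^ (n + m)) f))) : ℝ) =
      ‖(R ^ n) f‖ ^ 2 - ∑ a ∈ Finset.range m, ∑ i,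
        j i ((R ^ (n + a)) f) * inner ℝ (J ((R ^ n) f)) ((S ^ a) (θ i)) := fun n => by
    have h1 := h.decomp_pow ((R ^ n) f) m
    have h2 : ∀ a, (R ^ a) ((R ^ n) f) = (R ^ (n + a)) f := fun a => by
      rw [add_comm, pow_add, mul_apply_eq_comp]
    simp only [h2] at h1
    have h3 := congrArg (fun x => (inner ℝ (J ((R ^ n) f)) x : ℝ)) h1
    simp only [inner_add_right, inner_sum, map_sum, map_smul, real_inner_smul_right] at h3
    rw [real_inner_self_eq_norm_sq, J.norm_map] at h3
    linarith
  simp only [key]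
  have h0 : Tendsto (fun n : ℕ => ∑ a ∈ Finset.range m, ∑ i,
      j i ((R ^ (n + a)) f) * (inner ℝ (J ((R ^ n) f)) ((S ^ a) (θ i)) : ℝ)) atTop (𝓝 0) := by
    rw [show (0 : ℝ) = ∑ a ∈ Finset.range m, ∑ i : ι, 0 by simp]
    refine tendsto_finsetSum _ fun a _ => tendsto_finsetSum _ fun i _ => ?_
    have h4 := ((tendsto_add_atTop_iff_nat a).2 (h.tendsto_coeff f i)).abs.mul_const (‖f‖ * ‖θ i‖)
    rw [abs_zero, zero_mul] at h4
    refine squeeze_zero_norm (fun n => ?_) h4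
    rw [norm_mul, Real.norm_eq_abs, Real.norm_eq_abs]
    refine mul_le_mul_of_nonneg_left ((abs_real_inner_le_norm _ _).trans ?_) (abs_nonneg _)
    rw [J.norm_map, h.norm_shift_pow]
    have := h.antitone_norm f (Nat.zero_le n)
    simp only [pow_zero, one_apply_eq_self] at this
    gcongr
  have h5 := (hq.sub h0).comp hk
  rw [sub_zero] at h5
  exact h5

/-- Orbits of smooth vectors tend to zero. -/
theorem tendsto_of_isSmooth [CompleteSpace M] [CompleteSpace H]
    (h : ShiftDecomposition J S B R θ j) {f : M} (hf : IsSmooth R f) :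
    Tendsto (fun k : ℕ => (R ^ k) f) atTop (𝓝 0) := by
  obtain ⟨C, hC⟩ := hf
  -- `C` carries no sign, and the Cauchy–Schwarz bound needs a nonnegative constant.
  replace hC : ∀ (y : M) (N : ℕ),
      ∑ a ∈ Finset.range N, (inner ℝ y ((R ^ a) f) : ℝ) ^ 2 ≤ max C 0 * ‖y‖ ^ 2 := fun y N =>
    (hC y N).trans (mul_le_mul_of_nonneg_right (le_max_left _ _) (sq_nonneg _))
  set T := max C 0 * ∑ i, ‖θ i‖ ^ 2
  have hanti : Antitone fun k : ℕ => ‖(R ^ k) f‖ ^ 2 := fun a b hab => by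
    have := h.antitone_norm f hab
    simp only at this ⊢
    gcongr
  have hbdd : BddBelow (Set.range fun k : ℕ => ‖(R ^ k) f‖ ^ 2) :=
    ⟨0, by rintro _ ⟨k, rfl⟩; positivity⟩
  have hlim := tendsto_atTop_ciInf hanti hbdd
  have hle : ∀ k, ⨅ k : ℕ, ‖(R ^ k) f‖ ^ 2 ≤ ‖(R ^ k) f‖ ^ 2 := fun k => ciInf_le hbdd k
  set q := ⨅ k : ℕ, ‖(R ^ k) f‖ ^ 2
  have hb : ∀ k m : ℕ, |(inner ℝ (J ((R ^ k) f)) ((S ^ m) (J ((R ^ (k + m)) f))) : ℝ) - q|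
      ≤ 2 * √((‖(R ^ k) f‖ ^ 2 - q) * T) := fun k m =>
    le_of_tendsto ((h.tendsto_correlation f k m hlim).const_sub _).abs
      (Eventually.of_forall fun N => h.abs_correlation_sub_le (le_max_right _ _) hC hle k m N)
  -- In the other limit, `m → ∞`, moving `S^m` across turns it into `B^m`, which tends strongly to
  -- zero.
  have hz : ∀ k : ℕ, Tendsto (fun m : ℕ => (inner ℝ (J ((R ^ k) f))
      ((S ^ m) (J ((R ^ (k + m)) f))) : ℝ)) atTop (𝓝 0) := fun k => by
    have h1 := (h.tendsto_pow (J ((R ^ k) f))).norm.mul_const ‖f‖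
    rw [norm_zero, zero_mul] at h1
    refine squeeze_zero_norm (fun m => ?_) h1
    rw [h.inner_shift_pow]
    refine (norm_inner_le_norm _ _).trans (mul_le_mul_of_nonneg_left ?_ (norm_nonneg _))
    have := h.antitone_norm f (Nat.zero_le (k + m))
    simpa using this
  have hq : ∀ k : ℕ, |0 - q| ≤ 2 * √((‖(R ^ k) f‖ ^ 2 - q) * T) := fun k =>
    le_of_tendsto ((hz k).sub_const q).abs (Eventually.of_forall fun m => hb k m)
  -- Letting `k → ∞` makes the right side of `hq` vanish.
  have hq0 : q = 0 := by
    have h1 := (((hlim.sub_const q).mul_const T).sqrt).const_mul 2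
    rw [sub_self, zero_mul, Real.sqrt_zero, mul_zero] at h1
    have h2 := ge_of_tendsto' h1 hq
    simpa using h2
  rw [hq0] at hlim
  have h3 := hlim.sqrt
  simp only [Real.sqrt_sq (norm_nonneg _), Real.sqrt_zero] at h3
  exact tendsto_zero_iff_norm_tendsto_zero.2 h3

/-- Since I - RR* is self-adjoint, pairing `y` with the orbit is pairing `w` with (I - RR*)(R*)^a y.
The squared norm of the latter is at most ‖(R*)^a y‖² - ‖(R*)^(a+1) y‖², and these differences
telescope. -/
theorem isSmooth_sub_comp_adjoint [CompleteSpace M] (h : ShiftDecomposition J S B R θ j) (w : M) :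
    IsSmooth R (w - R (ContinuousLinearMap.adjoint R w)) := by
  set A := ContinuousLinearMap.adjoint R
  refine ⟨‖w‖ ^ 2, fun y N => ?_⟩
  have hdef : ∀ x, ‖x - R (A x)‖ ^ 2 ≤ ‖x‖ ^ 2 - ‖A x‖ ^ 2 := fun x => by
    have h1 : (inner ℝ x (R (A x)) : ℝ) = ‖A x‖ ^ 2 := by
      rw [← ContinuousLinearMap.adjoint_inner_left, real_inner_self_eq_norm_sq]
    rw [norm_sub_sq_real, h1]
    have h2 := h.norm_map_le (A x)
    have h3 : ‖R (A x)‖ ^ 2 ≤ ‖A x‖ ^ 2 := by gcongr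
    linarith
  have hmove : ∀ (a : ℕ) (x : M), (inner ℝ y ((R ^ a) x) : ℝ) = inner ℝ ((A ^ a) y) x := by
    intro a
    induction a with
    | zero => simp
    | succ a ih =>
      intro x
      rw [pow_succ R, pow_succ' A, mul_apply_eq_comp, mul_apply_eq_comp, ih,
        ContinuousLinearMap.adjoint_inner_left]
  have hterm : ∀ a : ℕ, (inner ℝ y ((R ^ a) (w - R (A w))) : ℝ) ^ 2 ≤
      ‖w‖ ^ 2 * (‖(A ^ a) y‖ ^ 2 - ‖(A ^ (a + 1)) y‖ ^ 2) := fun a => by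
    have h1 : (inner ℝ y ((R ^ a) (w - R (A w))) : ℝ) =
        inner ℝ w ((A ^ a) y - R (A ((A ^ a) y))) := by
      rw [hmove, inner_sub_right, inner_sub_right, real_inner_comm w,
        ← ContinuousLinearMap.adjoint_inner_left R (A w),
        ← ContinuousLinearMap.adjoint_inner_left R (A ((A ^ a) y)), real_inner_comm (A w)]
    have h2 := hdef ((A ^ a) y)
    rw [h1, pow_succ' A, mul_apply_eq_comp A, ← sq_abs]
    refine le_trans (pow_le_pow_left₀ (abs_nonneg _) (abs_real_inner_le_norm _ _) 2) ?_
    rw [mul_pow]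
    exact mul_le_mul_of_nonneg_left h2 (sq_nonneg _)
  refine (Finset.sum_le_sum fun a _ => hterm a).trans ?_
  rw [← Finset.mul_sum, Finset.sum_range_sub']
  simp only [pow_zero, one_apply_eq_self]
  exact mul_le_mul_of_nonneg_left (by linarith [sq_nonneg ‖(A ^ N) y‖]) (sq_nonneg _)

/-! ### The stable subspace and its orthogonal complement. -/

theorem norm_pow_le (h : ShiftDecomposition J S B R θ j) (k : ℕ) (f : M) :
    ‖(R ^ k) f‖ ≤ ‖f‖ := by
  have := h.antitone_norm f (Nat.zero_le k)
  simpa only [pow_zero, one_apply_eq_self] using this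

/-- The vectors whose orbits tend to zero. -/
def stable (R : M →L[ℝ] M) : Submodule ℝ M where
  carrier := {f | Tendsto (fun k : ℕ => (R ^ k) f) atTop (𝓝 0)}
  zero_mem' := by simp
  add_mem' {f g} hf hg := by
    have := Tendsto.add hf hg
    simp only [add_zero] at this
    simpa only [Set.mem_ofPred_eq, map_add] using this
  smul_mem' c f hf := by
    have := Tendsto.const_smul hf c
    simp only [smul_zero] at this
    simpa only [Set.mem_ofPred_eq, map_smul] using this

theorem mem_stable {f : M} : f ∈ stable R ↔ Tendsto (fun k : ℕ => (R ^ k) f) atTop (𝓝 0) :=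
  Iff.rfl

theorem map_mem_stable_iff {f : M} : R f ∈ stable R ↔ f ∈ stable R := by
  rw [mem_stable, mem_stable, ← tendsto_add_atTop_iff_nat (f := fun k : ℕ => (R ^ k) f) 1]
  simp only [pow_succ R, mul_apply_eq_comp]

theorem isClosed_stable (h : ShiftDecomposition J S B R θ j) : IsClosed (stable R : Set M) := by
  refine isClosed_of_closure_subset fun f hf => ?_
  change Tendsto (fun k : ℕ => (R ^ k) f) atTop (𝓝 0)
  rw [Metric.tendsto_atTop]
  intro ε hε
  obtain ⟨g, hg, hfg⟩ := Metric.mem_closure_iff.1 hf (ε / 2) (half_pos hε)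
  obtain ⟨N, hN⟩ := Metric.tendsto_atTop.1 (mem_stable.1 hg) (ε / 2) (half_pos hε)
  refine ⟨N, fun k hk => ?_⟩
  have h1 := hN k hk
  have h2 := h.norm_pow_le k (f - g)
  rw [dist_eq_norm] at hfg
  rw [dist_zero_right] at h1 ⊢
  have h3 : (R ^ k) f = (R ^ k) (f - g) + (R ^ k) g := by rw [← map_add, sub_add_cancel]
  rw [h3]
  exact (norm_add_le _ _).trans_lt (by linarith)

/-- Every orbit of `R` tends to zero. -/
theorem tendsto_orbit [CompleteSpace M] [CompleteSpace H] (h : ShiftDecomposition J S B R θ j)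
    (f : M) : Tendsto (fun k : ℕ => (R ^ k) f) atTop (𝓝 0) := by
  have hcl := h.isClosed_stable
  have : CompleteSpace (stable R) := hcl.completeSpace_coe
  set A := ContinuousLinearMap.adjoint R
  -- The range of the self-adjoint operator I - RR* is stable, so its kernel contains the
  -- complement.
  have hfix : ∀ y ∈ (stable R)ᗮ, R (A y) = y := fun y hy => by
    rw [eq_comm, ← sub_eq_zero]
    refine ext_inner_left ℝ fun w => ?_
    have h1 := (Submodule.mem_orthogonal _ _).1 hy _
      (h.tendsto_of_isSmooth (h.isSmooth_sub_comp_adjoint w))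
    have h2 : (inner ℝ (R (A w)) y : ℝ) = inner ℝ w (R (A y)) := by
      rw [← ContinuousLinearMap.adjoint_inner_right, ContinuousLinearMap.adjoint_inner_left]
    rw [inner_sub_left, h2] at h1
    rw [inner_zero_right, inner_sub_right, h1]
  have hinv : ∀ y ∈ (stable R)ᗮ, A y ∈ (stable R)ᗮ := fun y hy => by
    rw [Submodule.mem_orthogonal]
    intro z hz
    rw [ContinuousLinearMap.adjoint_inner_right]
    exact (Submodule.mem_orthogonal _ _).1 hy _ (map_mem_stable_iff.2 hz)
  -- Split R y = z + y' with z stable. Then R(y - A y') = z, so y - A y' is both stable and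
  -- orthogonal to the stable vectors; hence y = A y' and R y = y'.
  have hmap : ∀ y ∈ (stable R)ᗮ, R y ∈ (stable R)ᗮ ∧ ‖R y‖ = ‖y‖ := fun y hy => by
    obtain ⟨z, hz, y', hy', hzy⟩ := (stable R).exists_add_mem_mem_orthogonal (R y)
    have h1 : y - A y' ∈ stable R := by
      rw [← map_mem_stable_iff, map_sub, hfix y' hy', hzy, add_sub_cancel_right]
      exact hz
    have h2 : y - A y' = 0 := by
      have := (Submodule.mem_orthogonal _ _).1 (sub_mem hy (hinv y' hy')) _ h1
      exact inner_self_eq_zero.1 this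
    have h3 : R y = y' := by rw [sub_eq_zero.1 h2, hfix y' hy']
    refine ⟨h3 ▸ hy', ?_⟩
    rw [h3, ← sq_eq_sq₀ (norm_nonneg _) (norm_nonneg _), ← real_inner_self_eq_norm_sq,
      ← real_inner_self_eq_norm_sq, sub_eq_zero.1 h2, ContinuousLinearMap.adjoint_inner_right,
      hfix y' hy']
  have hzero : ∀ y ∈ (stable R)ᗮ, y = 0 := fun y hy => by
    have h1 : ∀ k : ℕ, (R ^ k) y ∈ (stable R)ᗮ ∧ ‖(R ^ k) y‖ = ‖y‖ := fun k => by
      induction k with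
      | zero => simpa using hy
      | succ k ih =>
        rw [pow_succ_apply]
        exact ⟨(hmap _ ih.1).1, (hmap _ ih.1).2.trans ih.2⟩
    have h2 : ∀ (k : ℕ) (i : ι), j i ((R ^ k) y) = 0 := fun k i => by
      have h3 := h.norm_sq ((R ^ k) y)
      rw [(hmap _ (h1 k).1).2, left_eq_add,
        Finset.sum_eq_zero_iff_of_nonneg fun _ _ => sq_nonneg _] at h3
      exact pow_eq_zero_iff two_ne_zero |>.1 (h3 i (Finset.mem_univ i))
    -- With no coefficients left, y lies in the range of every S^m; purity of `S` excludes this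
    -- unless y = 0.
    have h4 : ∀ m : ℕ, ‖y‖ ^ 2 ≤ ‖(B ^ m) (J y)‖ * ‖y‖ := fun m => by
      have h5 := h.decomp_pow y m
      simp only [h2, zero_smul, Finset.sum_const_zero, map_zero, add_zero] at h5
      calc ‖y‖ ^ 2 = inner ℝ (J y) ((S ^ m) (J ((R ^ m) y))) := by
            rw [← h5, real_inner_self_eq_norm_sq, J.norm_map]
        _ ≤ ‖(B ^ m) (J y)‖ * ‖J ((R ^ m) y)‖ := by
            rw [h.inner_shift_pow]
            exact real_inner_le_norm _ _
        _ = _ := by rw [J.norm_map, (h1 m).2]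
    have h6 := (h.tendsto_pow (J y)).norm.mul_const ‖y‖
    rw [norm_zero, zero_mul] at h6
    have h7 := ge_of_tendsto' h6 h4
    exact norm_eq_zero.1 (pow_eq_zero_iff two_ne_zero |>.1 (le_antisymm h7 (sq_nonneg _)))
  have htop : stable R = ⊤ := by
    rw [← Submodule.orthogonal_eq_bot_iff, Submodule.eq_bot_iff]
    exact hzero
  exact mem_stable.1 (htop ▸ Submodule.mem_top)

theorem hasSum_sq_orbit [CompleteSpace M] [CompleteSpace H] (h : ShiftDecomposition J S B R θ j)
    (f : M) : HasSum (fun k : ℕ => ∑ i, (j i ((R ^ k) f)) ^ 2) (‖f‖ ^ 2) := by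
  rw [hasSum_iff_tendsto_nat_of_nonneg fun k => Finset.sum_nonneg fun _ _ => sq_nonneg _]
  have h1 := (((h.tendsto_orbit f).norm.pow 2).const_sub (‖f‖ ^ 2))
  simp only [norm_zero, ne_eq, OfNat.ofNat_ne_zero, not_false_eq_true, zero_pow, sub_zero] at h1
  refine h1.congr fun N => ?_
  have h2 := h.sum_sq_orbit f 0 N
  simp only [zero_add, pow_zero, one_apply_eq_self] at h2
  exact h2.symm

end ShiftDecomposition

end

/-! ### Shifts and evaluations on the Hardy space. -/

noncomputable section
open Filter Topology
open scoped Complex.UnitDisc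

namespace RealHardy

theorem hasSum_norm_sq {E : Type*} [NormedAddCommGroup E] (F : HardyOf E) :
    HasSum (fun k => ‖F k‖ ^ 2) (‖F‖ ^ 2) := by
  have := lp.hasSum_norm (p := 2) (by norm_num) F
  simpa using this

theorem memlp_two_of_summable {E : Type*} [NormedAddCommGroup E] {u : ℕ → E}
    (hu : Summable fun k => ‖u k‖ ^ 2) : Memℓp u 2 :=
  memℓp_gen (by simpa using hu)

theorem backwardShift_apply {E : Type*} [NormedAddCommGroup E] [NormedSpace ℝ E] (F : HardyOf E)
    (k : ℕ) : backwardShift F k = F (k + 1) := rfl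

theorem norm_sq_eq_add_backwardShift {E : Type*} [NormedAddCommGroup E] [NormedSpace ℝ E]
    (F : HardyOf E) : ‖F‖ ^ 2 = ‖F 0‖ ^ 2 + ‖backwardShift F‖ ^ 2 := by
  rw [← (hasSum_norm_sq F).tsum_eq, (hasSum_norm_sq F).summable.tsum_eq_zero_add,
    ← (hasSum_norm_sq (backwardShift F)).tsum_eq]
  rfl

/-- The backward shift on `H²_ℝ(𝔻)` as a bounded operator. -/
def backwardShiftL : H2 →L[ℝ] H2 :=
  backwardShift.mkContinuous 1 fun F => by
    rw [one_mul]
    exact le_of_sq_le_sq (by linarith [norm_sq_eq_add_backwardShift F, sq_nonneg ‖F 0‖])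
      (norm_nonneg _)

theorem backwardShiftL_apply (f : H2) : backwardShiftL f = backwardShift f := rfl

theorem backwardShiftL_pow_apply (m : ℕ) (f : H2) (k : ℕ) :
    ((backwardShiftL ^ m) f) k = f (k + m) := by
  induction m generalizing f with
  | zero => rfl
  | succ m ih =>
    rw [pow_succ, mul_apply_eq_comp, ih, backwardShiftL_apply, backwardShift_apply, add_assoc]

theorem tendsto_backwardShiftL_pow (f : H2) :
    Tendsto (fun m : ℕ => (backwardShiftL ^ m) f) atTop (𝓝 0) := by
  rw [tendsto_zero_iff_norm_tendsto_zero]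
  have h1 : ∀ m : ℕ, ‖(backwardShiftL ^ m) f‖ = √(∑' k, ‖f (k + m)‖ ^ 2) := fun m => by
    rw [← Real.sqrt_sq (norm_nonneg ((backwardShiftL ^ m) f)), ← (hasSum_norm_sq _).tsum_eq]
    simp only [backwardShiftL_pow_apply]
  simp only [h1]
  simpa only [Real.sqrt_zero] using (tendsto_sum_nat_add fun k => ‖f k‖ ^ 2).sqrt

/-- The sequence `0, a 0, a 1, …`. -/
def prependZero (a : ℕ → ℝ) : ℕ → ℝ
  | 0 => 0
  | k + 1 => a k

theorem summable_prependZero (f : H2) : Summable fun k : ℕ => ‖prependZero f k‖ ^ 2 :=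
  (summable_nat_add_iff 1).1 (hasSum_norm_sq f).summable

/-- Multiplication by `z` on `H²_ℝ(𝔻)`. -/
def forwardShift : H2 →ₗ[ℝ] H2 where
  toFun f := ⟨prependZero f, memlp_two_of_summable (summable_prependZero f)⟩
  map_add' f g := by
    ext k
    cases k with
    | zero => exact (add_zero (0 : ℝ)).symm
    | succ k => rfl
  map_smul' c f := by
    ext k
    cases k with
    | zero => exact (mul_zero c).symm
    | succ k => rfl

theorem forwardShift_zero (f : H2) : forwardShift f 0 = 0 := rfl

theorem backwardShift_forwardShift (f : H2) : backwardShift (forwardShift f) = f := rfl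

theorem forwardShift_backwardShift {f : H2} (hf : f 0 = 0) :
    forwardShift (backwardShift f) = f := by
  ext k
  cases k with
  | zero => exact hf.symm
  | succ k => rfl

/-- Multiplication by `z` on `H²_ℝ(𝔻)` as a bounded operator. -/
def forwardShiftL : H2 →L[ℝ] H2 :=
  forwardShift.mkContinuous 1 fun f => by
    rw [one_mul]
    refine le_of_sq_le_sq ?_ (norm_nonneg _)
    rw [norm_sq_eq_add_backwardShift (forwardShift f), backwardShift_forwardShift,
      forwardShift_zero]
    simp

theorem forwardShiftL_apply (f : H2) : forwardShiftL f = forwardShift f := rfl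

theorem inner_forwardShift (f g : H2) :
    (inner ℝ f (forwardShift g) : ℝ) = inner ℝ (backwardShift f) g := by
  have h1 := (lp.hasSum_inner (𝕜 := ℝ) f (forwardShift g)).tsum_eq
  have h2 := (lp.summable_inner (𝕜 := ℝ) f (forwardShift g)).tsum_eq_zero_add
  rw [h1, forwardShift_zero, inner_zero_right, zero_add] at h2
  rw [h2]
  exact (lp.hasSum_inner (𝕜 := ℝ) (backwardShift f) g).tsum_eq

theorem toFun_add (f g : H2) (z : 𝔻) : toFun (f + g) z = toFun f z + toFun g z := by
  have := toFun_sub (f + g) g z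
  rw [add_sub_cancel_right] at this
  rw [this, sub_add_cancel]

theorem toFun_smul (c : ℝ) (f : H2) (z : 𝔻) : toFun (c • f) z = c * toFun f z := by
  unfold toFun
  rw [← tsum_mul_left]
  refine tsum_congr fun k => ?_
  rw [lp.coeFn_smul, Pi.smul_apply, smul_eq_mul]
  push_cast
  ring

/-- Evaluation at a point of the disc. -/
def evalAt (z : 𝔻) : H2 →ₗ[ℝ] ℂ where
  toFun f := toFun f z
  map_add' f g := toFun_add f g z
  map_smul' c f := by simp [toFun_smul]

theorem evalAt_apply (z : 𝔻) (f : H2) : evalAt z f = toFun f z := rfl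

theorem toFun_forwardShift (f : H2) (z : 𝔻) : toFun (forwardShift f) z = z * toFun f z := by
  have := toFun_backwardShift (forwardShift f) z
  rw [backwardShift_forwardShift, toFun_zero, forwardShift_zero] at this
  simpa using this.symm

theorem norm_toFun_le (f : H2) (z : 𝔻) : ‖toFun f z‖ ≤ ‖f‖ * (1 - ‖(z : ℂ)‖)⁻¹ := by
  refine tsum_of_norm_bounded
    ((hasSum_geometric_of_lt_one (norm_nonneg (z : ℂ)) z.norm_lt_one).mul_left ‖f‖) fun k => ?_
  rw [norm_mul, norm_pow, Complex.norm_real]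
  gcongr
  exact lp.norm_apply_le_norm (by norm_num) f k

theorem toFun_forwardShiftL_pow (m : ℕ) (f : H2) (z : 𝔻) :
    toFun ((forwardShiftL ^ m) f) z = z ^ m * toFun f z := by
  induction m with
  | zero => simp
  | succ m ih =>
    rw [pow_succ', mul_apply_eq_comp, forwardShiftL_apply, toFun_forwardShift, ih]
    ring

/-- The element of `H²_ℝ(𝔻, ℂⁿ)` with given components. -/
def ofComponents {n : ℕ} : (Fin n → H2) →ₗ[ℝ] H2Vec n where
  toFun u := ⟨fun k => WithLp.toLp 2 fun i => u i k, memlp_two_of_summable (by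
    simp only [EuclideanSpace.norm_sq_eq]
    exact summable_sum fun i _ => (hasSum_norm_sq (u i)).summable)⟩
  map_add' _ _ := rfl
  map_smul' _ _ := rfl

theorem norm_sq_eq_sum_component {n : ℕ} (F : H2Vec n) :
    ‖F‖ ^ 2 = ∑ i, ‖component i F‖ ^ 2 := by
  rw [← (hasSum_norm_sq F).tsum_eq]
  simp only [EuclideanSpace.norm_sq_eq]
  exact (hasSum_sum fun i _ => hasSum_norm_sq (component i F)).tsum_eq

/-! ### Power series of orbit coefficients. -/

section Coefficients

variable {M : Submodule ℝ H2} [CompleteSpace M] {ι : Type*} [Fintype ι] {R : M →L[ℝ] M}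
  {θ : ι → H2} {j : ι → M →ₗ[ℝ] ℝ}

/-- The power series `∑ j_i(R^k f) z^k`. -/
def orbitCoeff (h : ShiftDecomposition M.subtypeₗᵢ forwardShiftL backwardShiftL R θ j) (i : ι) :
    M →ₗ[ℝ] H2 where
  toFun f := ⟨fun k => j i ((R ^ k) f), memlp_two_of_summable
    ((h.hasSum_sq_orbit f).summable.of_nonneg_of_le (fun _ => sq_nonneg _) fun k => by
      rw [Real.norm_eq_abs, sq_abs]
      exact Finset.single_le_sum (f := fun i => (j i ((R ^ k) f)) ^ 2)
        (fun _ _ => sq_nonneg _) (Finset.mem_univ i))⟩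
  map_add' f g := by
    ext k
    change j i ((R ^ k) (f + g)) = j i ((R ^ k) f) + j i ((R ^ k) g)
    rw [map_add, map_add]
  map_smul' c f := by
    ext k
    change j i ((R ^ k) (c • f)) = c * j i ((R ^ k) f)
    rw [map_smul, map_smul, smul_eq_mul]

theorem orbitCoeff_apply (h : ShiftDecomposition M.subtypeₗᵢ forwardShiftL backwardShiftL R θ j)
    (i : ι) (f : M) (k : ℕ) : orbitCoeff h i f k = j i ((R ^ k) f) := rfl

/-- This intertwining is the source of the shift invariance of `N`. -/
theorem backwardShift_orbitCoeff
    (h : ShiftDecomposition M.subtypeₗᵢ forwardShiftL backwardShiftL R θ j)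
    (i : ι) (f : M) : backwardShift (orbitCoeff h i f) = orbitCoeff h i (R f) := by
  ext k
  rw [backwardShift_apply, orbitCoeff_apply, orbitCoeff_apply, pow_succ, mul_apply_eq_comp]

theorem norm_sq_eq_sum_orbitCoeff
    (h : ShiftDecomposition M.subtypeₗᵢ forwardShiftL backwardShiftL R θ j) (f : M) :
    ‖f‖ ^ 2 = ∑ i, ‖orbitCoeff h i f‖ ^ 2 := by
  refine (h.hasSum_sq_orbit f).unique ?_
  have := hasSum_sum fun i (_ : i ∈ Finset.univ) => hasSum_norm_sq (orbitCoeff h i f)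
  simpa only [orbitCoeff_apply, Real.norm_eq_abs, sq_abs] using this

/-- Evaluate the iterated decomposition at `z`. The remainder tends to zero because the orbit does
and point evaluation is bounded. -/
theorem toFun_eq_sum_orbitCoeff
    (h : ShiftDecomposition M.subtypeₗᵢ forwardShiftL backwardShiftL R θ j) (f : M) (z : 𝔻) :
    toFun f z = ∑ i, toFun (orbitCoeff h i f) z * toFun (θ i) z := by
  have h1 : HasSum (fun k : ℕ => ∑ i, ((orbitCoeff h i f k : ℝ) : ℂ) * (z : ℂ) ^ k * toFun (θ i) z)
      (∑ i, toFun (orbitCoeff h i f) z * toFun (θ i) z) :=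
    hasSum_sum fun i _ => (summable_toFun (orbitCoeff h i f) z).hasSum.mul_right _
  have h2 : Tendsto (fun m : ℕ => toFun ((forwardShiftL ^ m) ((R ^ m) f : M)) z) atTop (𝓝 0) := by
    have h3 := ((h.tendsto_orbit f).norm).mul_const (1 - ‖(z : ℂ)‖)⁻¹
    rw [norm_zero, zero_mul] at h3
    refine squeeze_zero_norm (fun m => ?_) h3
    refine (norm_toFun_le _ z).trans_eq ?_
    rw [h.norm_shift_pow]
    rfl
  have h4 : ∀ m : ℕ, toFun f z - toFun ((forwardShiftL ^ m) ((R ^ m) f : M)) z =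
      ∑ k ∈ Finset.range m, ∑ i, ((orbitCoeff h i f k : ℝ) : ℂ) * (z : ℂ) ^ k * toFun (θ i) z :=
    fun m => by
      have h5 := congrArg (evalAt z) (h.decomp_pow f m)
      rw [map_add, map_sum] at h5
      simp only [map_sum, map_smul] at h5
      simp only [evalAt_apply, Complex.real_smul] at h5
      rw [sub_eq_iff_eq_add']
      refine h5.trans (congrArg _ (Finset.sum_congr rfl fun k _ => Finset.sum_congr rfl fun i _ => ?_))
      rw [toFun_forwardShiftL_pow, orbitCoeff_apply]
      ring
  have h6 := (h2.const_sub (toFun f z)).congr h4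
  rw [sub_zero] at h6
  exact tendsto_nhds_unique h6 h1.tendsto_sum_nat

end Coefficients

/-! ### The decomposition attached to a nearly invariant subspace. -/

theorem toFun_zero_eq_zero_iff {f : H2} : toFun f 0 = 0 ↔ f 0 = 0 := by
  rw [toFun_zero, Complex.ofReal_eq_zero]

/-- The coefficients of the defect part and the remainder of an element of `M ⊕ F`. -/
theorem eq_starProjection_add_sum {n : ℕ} {M F : Submodule ℝ H2} [M.HasOrthogonalProjection]
    (hMF : M ⟂ F) (e : OrthonormalBasis (Fin n) ℝ F) {x : H2} (hx : x ∈ M ⊔ F) :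
    x = M.orthogonalProjectionOnto x + ∑ i, (inner ℝ (e i : H2) x : ℝ) • (e i : H2) ∧
    ‖x‖ ^ 2 = ‖M.orthogonalProjectionOnto x‖ ^ 2 + ∑ i, (inner ℝ (e i : H2) x : ℝ) ^ 2 := by
  obtain ⟨a, ha, b, hb, rfl⟩ := Submodule.mem_sup.1 hx
  have hab : (inner ℝ a b : ℝ) = 0 := hMF.inner_eq ha hb
  have h1 : (M.orthogonalProjectionOnto (a + b) : H2) = a := by
    refine Submodule.eq_starProjection_of_mem_of_inner_eq_zero ha fun w hw => ?_
    rw [add_sub_cancel_left, real_inner_comm]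
    exact hMF.inner_eq hw hb
  have h2 : ∀ i, (inner ℝ (e i : H2) (a + b) : ℝ) = inner ℝ (e i) (⟨b, hb⟩ : F) := fun i => by
    rw [inner_add_right, real_inner_comm, hMF.inner_eq ha (e i).2, zero_add]
    rfl
  have h3 : b = ∑ i, (inner ℝ (e i) (⟨b, hb⟩ : F) : ℝ) • (e i : H2) := by
    have := congrArg (F.subtype) (e.sum_repr' ⟨b, hb⟩)
    rw [map_sum] at this
    exact this.symm
  have h4 : ‖b‖ ^ 2 = ∑ i, (inner ℝ (e i) (⟨b, hb⟩ : F) : ℝ) ^ 2 :=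
    (e.sum_sq_inner_right ⟨b, hb⟩).symm
  simp only [h2]
  rw [← h3, ← h4, show ‖M.orthogonalProjectionOnto (a + b)‖ = ‖a‖ from congrArg norm h1, h1]
  refine ⟨rfl, ?_⟩
  rw [norm_add_sq_real, hab]
  ring

/-- The hypotheses on `g` hold both for an extremal function and for `g = 0` when `M` vanishes at 0,
so both cases of the theorem come from here. -/
theorem exists_coefficients {n : ℕ} {M F : Submodule ℝ H2} [CompleteSpace M]
    (hF : AbsorbsDefect M F) (e : OrthonormalBasis (Fin n) ℝ F) {g : H2} (hgM : g ∈ M)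
    (hg0 : ∀ f ∈ M, toFun (f - (inner ℝ g f : ℝ) • g) 0 = 0)
    (hgn : ∀ f : H2, ‖f‖ ^ 2 = (inner ℝ g f : ℝ) ^ 2 + ‖f - (inner ℝ g f : ℝ) • g‖ ^ 2) :
    ∃ (R : M →L[ℝ] M) (a : M →ₗ[ℝ] H2) (b : M →ₗ[ℝ] H2Vec n),
      (∀ f : M, toFun (f : H2) = toFun g * toFun (a f) + defectPart (fun i => (e i : H2)) (b f)) ∧
      (∀ f, ‖f‖ ^ 2 = ‖a f‖ ^ 2 + ‖b f‖ ^ 2) ∧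
      (∀ f, backwardShift (a f) = a (R f)) ∧ (∀ f, backwardShift (b f) = b (R f)) ∧
      (g = 0 → a = 0) := by
  let D : M →L[ℝ] H2 := backwardShiftL ∘L (M.subtypeL - ((innerSL ℝ g).comp M.subtypeL).smulRight g)
  have hD : ∀ f : M, D f = backwardShift ((f : H2) - (inner ℝ g (f : H2) : ℝ) • g) := fun f => rfl
  have hDmem : ∀ f : M, D f ∈ M ⊔ F := fun f =>
    hF.backwardShift_mem _ (M.sub_mem f.2 (M.smul_mem _ hgM)) (hg0 f f.2)
  let R : M →L[ℝ] M := M.orthogonalProjectionOnto ∘L D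
  -- The index `none` carries `g`; `some i` carries z eᵢ.
  let θ : Option (Fin n) → H2 := fun o => o.elim g fun i => forwardShift (e i)
  let j : Option (Fin n) → M →ₗ[ℝ] ℝ := fun o =>
    o.elim ((innerSL ℝ g).comp M.subtypeL).toLinearMap
      fun i => ((innerSL ℝ (e i : H2)).comp D).toLinearMap
  have h : ShiftDecomposition M.subtypeₗᵢ forwardShiftL backwardShiftL R θ j := by
    refine ⟨inner_forwardShift, backwardShift_forwardShift, tendsto_backwardShiftL_pow,
      fun f => ?_, fun f => ?_⟩
    · have h1 := (eq_starProjection_add_sum hF.orthogonal e (hDmem f)).1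
      have h2 : forwardShift (D f) = (f : H2) - (inner ℝ g (f : H2) : ℝ) • g :=
        forwardShift_backwardShift (toFun_zero_eq_zero_iff.1 (hg0 f f.2))
      have h3 : forwardShift (D f) = forwardShift (R f) +
          ∑ i, (inner ℝ (e i : H2) (D f) : ℝ) • forwardShift (e i) := by
        conv_lhs => rw [h1, map_add, map_sum]
        simp only [map_smul]
        rfl
      rw [Fintype.sum_option]
      change (f : H2) = forwardShift (R f) + ((inner ℝ g (f : H2) : ℝ) • g +
          ∑ i, (inner ℝ (e i : H2) (D f) : ℝ) • forwardShift (e i))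
      rw [h2, sub_eq_iff_eq_add] at h3
      exact h3.trans (by abel)
    · have h1 := (eq_starProjection_add_sum hF.orthogonal e (hDmem f)).2
      -- The backward shift loses only the constant term, which is zero here.
      have h2 : ‖D f‖ ^ 2 = ‖(f : H2) - (inner ℝ g (f : H2) : ℝ) • g‖ ^ 2 := by
        rw [norm_sq_eq_add_backwardShift (_ - _), toFun_zero_eq_zero_iff.1 (hg0 f f.2), hD]
        simp
      rw [Fintype.sum_option]
      change ‖(f : H2)‖ ^ 2 = ‖M.orthogonalProjectionOnto (D f)‖ ^ 2 + ((inner ℝ g (f : H2) : ℝ) ^ 2 +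
          ∑ i, (inner ℝ (e i : H2) (D f) : ℝ) ^ 2)
      rw [hgn f, ← h2, h1]
      ring
  let b : M →ₗ[ℝ] H2Vec n := ofComponents ∘ₗ LinearMap.pi fun i => orbitCoeff h (some i)
  have hb : ∀ f i, component i (b f) = orbitCoeff h (some i) f := fun f i => rfl
  refine ⟨R, orbitCoeff h none, b, fun f => ?_, fun f => ?_, backwardShift_orbitCoeff h none,
    fun f => ?_, fun hg => ?_⟩
  · funext z
    rw [toFun_eq_sum_orbitCoeff h, Fintype.sum_option, Pi.add_apply, Pi.mul_apply, defectPart,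
      Finset.mul_sum, mul_comm]
    refine congrArg _ (Finset.sum_congr rfl fun i _ => ?_)
    change _ * toFun (forwardShift (e i)) z = _
    rw [toFun_forwardShift, hb]
    ring
  · rw [norm_sq_eq_sum_orbitCoeff h, Fintype.sum_option, norm_sq_eq_sum_component]
    rfl
  · change _ = ofComponents fun i => orbitCoeff h (some i) (R f)
    simp only [← backwardShift_orbitCoeff]
    rfl
  · ext f k
    change (inner ℝ g _ : ℝ) = 0
    rw [hg, inner_zero_left]

/-! ### Extremal functions. -/

theorem IsExtremal.coeff_pos {M : Submodule ℝ H2} {g : H2} (hg : IsExtremal M g) : 0 < g 0 := by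
  simpa [toFun_zero] using hg.pos

/-- Subtracting (f(0)/g(0)) g kills the value at 0, and orthogonality then identifies f(0)/g(0) with
⟨g, f⟩. -/
theorem IsExtremal.toFun_sub_smul_zero {M : Submodule ℝ H2} {g f : H2} (hg : IsExtremal M g)
    (hf : f ∈ M) : toFun (f - (inner ℝ g f : ℝ) • g) 0 = 0 := by
  have hv : toFun (f - (f 0 / g 0) • g) 0 = 0 := by
    rw [toFun_zero_eq_zero_iff]
    change f 0 - f 0 / g 0 * g 0 = 0
    rw [div_mul_cancel₀ _ hg.coeff_pos.ne', sub_self]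
  have h1 := hg.orthogonal _ (M.sub_mem hf (M.smul_mem _ hg.mem)) hv
  rw [inner_sub_right, real_inner_smul_right, real_inner_self_eq_norm_sq, hg.norm_eq_one,
    one_pow, mul_one, sub_eq_zero] at h1
  rwa [h1]

/-- The difference g' - ⟨g, g'⟩ g vanishes at 0, so it is orthogonal to both functions and hence to
itself. Norm and sign then fix the scalar. -/
theorem IsExtremal.unique {M : Submodule ℝ H2} {g g' : H2} (hg : IsExtremal M g)
    (hg' : IsExtremal M g') : g' = g := by
  set c : ℝ := inner ℝ g g'
  have hmem : g' - c • g ∈ M := M.sub_mem hg'.mem (M.smul_mem _ hg.mem)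
  have h0 := hg.toFun_sub_smul_zero hg'.mem
  have h1 := hg.orthogonal _ hmem h0
  have h2 := hg'.orthogonal _ hmem h0
  have h3 : g' = c • g := by
    rw [← sub_eq_zero, ← inner_self_eq_zero (𝕜 := ℝ), inner_sub_left, real_inner_smul_left, h1, h2]
    ring
  have hc : g' 0 = c * g 0 := congrArg (fun f : H2 => f 0) h3
  have hcpos : 0 < c := pos_of_mul_pos_left (hc ▸ hg'.coeff_pos) hg.coeff_pos.le
  have h4 := congrArg norm h3
  rw [norm_smul, hg.norm_eq_one, hg'.norm_eq_one, Real.norm_of_nonneg hcpos.le, mul_one] at h4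
  rw [h3, ← h4, one_smul]

/-- Normalize the Riesz representative r of evaluation at 0 on `M`; its value r(0) = ‖r‖² is
positive. -/
theorem exists_isExtremal {M : Submodule ℝ H2} [CompleteSpace M] {f : H2} (hf : f ∈ M)
    (hf0 : toFun f 0 ≠ 0) : ∃ g, IsExtremal M g := by
  let ev : M →L[ℝ] ℝ := (lp.evalCLM ℝ (fun _ : ℕ => ℝ) 2 0).comp M.subtypeL
  have hev : ∀ u : M, ev u = (u : H2) 0 := fun u => rfl
  set r : M := (InnerProductSpace.toDual ℝ M).symm ev
  have hr : ∀ u : M, (inner ℝ r u : ℝ) = (u : H2) 0 := fun u => by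
    rw [InnerProductSpace.toDual_symm_apply, hev]
  have hr0 : r ≠ 0 := fun h0 => hf0 (by
    have := hr ⟨f, hf⟩
    rw [h0, inner_zero_left] at this
    exact toFun_zero_eq_zero_iff.2 this.symm)
  have hn : 0 < ‖r‖ := norm_pos_iff.2 hr0
  refine ⟨‖r‖⁻¹ • (r : H2), M.smul_mem _ r.2, norm_smul_inv_norm (𝕜 := ℝ) (x := (r : H2))
    (by simpa using hr0), fun u hu hu0 => ?_, ?_⟩
  · have h1 : (inner ℝ (r : H2) u : ℝ) = u 0 := hr ⟨u, hu⟩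
    rw [real_inner_smul_left, h1, toFun_zero_eq_zero_iff.1 hu0, mul_zero]
  · have h1 : ‖r‖ ^ 2 = (r : H2) 0 := by rw [← hr, real_inner_self_eq_norm_sq]
    rw [toFun_zero, Complex.ofReal_re]
    change 0 < ‖r‖⁻¹ * (r : H2) 0
    rw [← h1]
    positivity

end RealHardy
end

/-! ### The coefficient space as an isometric image of `M`. -/

theorem mainTheorem2 (n : ℕ) (M : Submodule ℝ RealHardy.H2)
    (hMclosed : IsClosed (M : Set RealHardy.H2)) (hM : M ≠ ⊥)
    (hdefect : RealHardy.IsNearlyInvariantWithDefect M n)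
    (F : Submodule ℝ RealHardy.H2) (hF : RealHardy.IsDefectSpace M F)
    (e : OrthonormalBasis (Fin n) ℝ F) :
    ((∃ f ∈ M, RealHardy.toFun f 0 ≠ 0) →
      (∃! g : RealHardy.H2, RealHardy.IsExtremal M g) ∧
      ∀ g : RealHardy.H2, RealHardy.IsExtremal M g →
        ∃ N : Submodule ℝ (WithLp 2 (RealHardy.H2 × RealHardy.H2Vec n)),
          IsClosed (N : Set (WithLp 2 (RealHardy.H2 × RealHardy.H2Vec n))) ∧
          RealHardy.IsInvariantSum N ∧
          RealHardy.toFun '' (M : Set RealHardy.H2) =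
            {φ : Complex.UnitDisc → ℂ | ∃ p ∈ N,
              φ = RealHardy.toFun g * RealHardy.toFun p.fst +
                RealHardy.defectPart (fun i => (e i : RealHardy.H2)) p.snd} ∧
          ∀ f ∈ M, ∀ p ∈ N,
            RealHardy.toFun f = RealHardy.toFun g * RealHardy.toFun p.fst +
                RealHardy.defectPart (fun i => (e i : RealHardy.H2)) p.snd →
            ‖f‖ ^ 2 = ‖p.fst‖ ^ 2 + ∑ i, ‖RealHardy.component i p.snd‖ ^ 2) ∧
    ((∀ f ∈ M, RealHardy.toFun f 0 = 0) →
      ∃ N : Submodule ℝ (RealHardy.H2Vec n),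
        IsClosed (N : Set (RealHardy.H2Vec n)) ∧
        (∀ H ∈ N, RealHardy.backwardShift H ∈ N) ∧
        RealHardy.toFun '' (M : Set RealHardy.H2) =
          {φ : Complex.UnitDisc → ℂ | ∃ H ∈ N,
            φ = RealHardy.defectPart (fun i => (e i : RealHardy.H2)) H} ∧
        ∀ f ∈ M, ∀ H ∈ N,
          RealHardy.toFun f = RealHardy.defectPart (fun i => (e i : RealHardy.H2)) H →
          ‖f‖ ^ 2 = ∑ i, ‖RealHardy.component i H‖ ^ 2) := by
  have hcomplete : CompleteSpace M := hMclosed.completeSpace_coe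
  constructor
  · rintro ⟨f₀, hf₀, hf₀0⟩
    refine ⟨?_, fun g hg => ?_⟩
    · obtain ⟨g, hg⟩ := RealHardy.exists_isExtremal hf₀ hf₀0
      exact ⟨g, hg, fun g' hg' => hg.unique hg'⟩
    obtain ⟨R, a, b, hfun, hnorm, ha, hb, -⟩ := RealHardy.exists_coefficients hF.toAbsorbsDefect e
      hg.mem (fun f hf => hg.toFun_sub_smul_zero hf) (fun f => by
        rw [norm_sub_sq_real, real_inner_smul_right, norm_smul, hg.norm_eq_one, mul_one,
          real_inner_comm g f, Real.norm_eq_abs, sq_abs]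
        ring)
    let V : M →ₗᵢ[ℝ] WithLp 2 (RealHardy.H2 × RealHardy.H2Vec n) :=
      ⟨(WithLp.linearEquiv 2 ℝ (RealHardy.H2 × RealHardy.H2Vec n)).symm.toLinearMap ∘ₗ a.prod b,
        fun f => by
          rw [← sq_eq_sq₀ (norm_nonneg _) (norm_nonneg _), WithLp.prod_norm_sq_eq_of_L2, hnorm f]
          rfl⟩
    have hV1 : ∀ f, (V f).fst = a f := fun f => rfl
    have hV2 : ∀ f, (V f).snd = b f := fun f => rfl
    -- `N` is closed because it is the isometric image of a complete space.
    refine ⟨V.toLinearMap.range, ?_, ?_, ?_, ?_⟩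
    · rw [LinearMap.coe_range]
      exact V.isometry.isClosedEmbedding.isClosed_range
    · rintro _ ⟨f, rfl⟩
      refine ⟨R f, ?_⟩
      change WithLp.toLp 2 (a (R f), b (R f)) = WithLp.toLp 2 (_, _)
      rw [← ha, ← hb]
      rfl
    · ext φ
      constructor
      · rintro ⟨f, hf, rfl⟩
        exact ⟨V ⟨f, hf⟩, ⟨_, rfl⟩, hfun ⟨f, hf⟩⟩
      · rintro ⟨_, ⟨f, rfl⟩, rfl⟩
        exact ⟨f, f.2, hfun f⟩
    · rintro f - _ ⟨f', rfl⟩ hff'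
      -- Every tuple in `N` comes from some f', and the function it represents determines f'.
      have h1 : f = f' := RealHardy.toFun_injective (hff'.trans (hfun f').symm)
      rw [h1, ← RealHardy.norm_sq_eq_sum_component]
      exact hnorm f'
  · intro h0
    -- Here g = 0, so the component `a` vanishes and only the defect part remains.
    obtain ⟨R, a, b, hfun, hnorm, -, hb, ha⟩ := RealHardy.exists_coefficients hF.toAbsorbsDefect e
      M.zero_mem (fun f hf => by simpa using h0 f hf) (fun f => by simp)
    replace hfun : ∀ f : M, RealHardy.toFun (f : RealHardy.H2) =
        RealHardy.defectPart (fun i => (e i : RealHardy.H2)) (b f) := fun f => by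
      rw [hfun f, ha rfl]
      funext z
      simp [RealHardy.toFun]
    replace hnorm : ∀ f : M, ‖f‖ ^ 2 = ‖b f‖ ^ 2 := fun f => by
      rw [hnorm f, ha rfl]
      simp
    let V : M →ₗᵢ[ℝ] RealHardy.H2Vec n :=
      ⟨b, fun f => by rw [← sq_eq_sq₀ (norm_nonneg _) (norm_nonneg _), hnorm f]⟩
    refine ⟨V.toLinearMap.range, ?_, ?_, ?_, ?_⟩
    · rw [LinearMap.coe_range]
      exact V.isometry.isClosedEmbedding.isClosed_range
    · rintro _ ⟨f, rfl⟩
      exact ⟨R f, (hb f).symm⟩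
    · ext φ
      constructor
      · rintro ⟨f, hf, rfl⟩
        exact ⟨V ⟨f, hf⟩, ⟨_, rfl⟩, hfun ⟨f, hf⟩⟩
      · rintro ⟨_, ⟨f, rfl⟩, rfl⟩
        exact ⟨f, f.2, hfun f⟩
    · rintro f - _ ⟨f', rfl⟩ hff'
      have h1 : f = f' := RealHardy.toFun_injective (hff'.trans (hfun f').symm)
      rw [h1, ← RealHardy.norm_sq_eq_sum_component]
      exact hnorm f'
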